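/- Consider an $n\times n$ input-queued switch with queues indexed by $(i,j)\in[n]\times[n]$ and costs $c_{ij}>0$. Write $\langle x,y\rangle_c=\sum_{ij}c_{ij}x_{ij}y_{ij}$ and $\|x\|_c^2=\langle x,x\rangle_c$ for $x,y\in\mathbb R^{n^2}$, and let $\|\cdot\|$ be the Euclidean norm. Let $\mathcal P$ be the set of maximal schedules, i.e. of $s\in\{0,1\}^{n^2}$ with exactly one $1$ in each row and each column. In time slot $t$, given the queue lengths $Q(t)\in\mathbb Z_+^{n^2}$, the $c$-weighted MaxWeight algorithm picks a schedule $S(t)$ uniformly at random among the maximizers of $\langle Q(t),s\rangle_c$ over $s\in\mathcal P$, and the queues evolve by $Q_{ij}(t+1)=Q_{ij}(t)+A_{ij}(t)-S_{ij}(t)+U_{ij}(t)$, where $U_{ij}(t)=\max\{S_{ij}(t)-Q_{ij}(t)-A_{ij}(t),0\}$ is the unused service. The numbers of arrivals $A_{ij}(t)\in\mathbb Z_+$ are independent over $t$ and $(i,j)$, identically distributed over $t$, and in each slot independent of the past and of the choice of the schedule. Let $\mathcal F=\{x\in\mathbb R_+^{n^2}:\sum_{j}x_{ij}=1\ \forall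 i,\ \sum_i x_{ij}=1\ \forall j\}$, and let $\nu$ be in the relative interior of $\mathcal F$ with $\nu_{\min}=\min_{ij}\nu_{ij}>0$. Consider a family of such switches indexed by $0<\epsilon<1$ with mean arrival rates $\mathbb E[A^{(\epsilon)}_{ij}(t)]=(1-\epsilon)\nu_{ij}$, with arrivals bounded by a constant $A_{\max}$, $A^{(\epsilon)}_{ij}(t)\le A_{\max}$ almost surely, and with $\sum_{ij}\operatorname{Var}(A^{(\epsilon)}_{ij}(t))\le\widetilde\sigma^2$, where $A_{\max}$ and $\widetilde\sigma$ do not depend on $\epsilon$. Let $\overline Q^{(\epsilon)}$ be a steady-state queue-length vector, i.e. a random vector distributed according to a stationary probability distribution of the Markov chain $Q^{(\epsilon)}(t)$. Let $\mathcal K_c=\{x\in\mathbb R^{n^2}:x_{ij}=(w_i+\tilde w_j)/c_{ij},\ w_i,\tilde w_j\ge0\}$ and, for $x\in\mathbb R^{n^2}$, let $x_{\perp_c}=x-x_{\parallel_c}$, where $x_{\parallel_c}=\arg\min_{y\in\mathcal K_c}\|x-y\|_c$. Then there are $\nu'_{\min}>0$ and real numbers $M_1,M_2,\dots$, which depend only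 on $n$, $c$, $\nu$, $A_{\max}$ and $\widetilde\sigma$ (and $M_r$ also on $r$) and in particular not on $\epsilon$, such that for every $0<\epsilon<1$ with $\epsilon\le\nu'_{\min}$ and every $r\in\{1,2,\dots\}$ $$\mathbb E\Big[\big\|\overline Q^{(\epsilon)}_{\perp_c}\big\|^r\Big]\le (M_r)^r<\infty .$$ -/

import Mathlib

open MeasureTheory ProbabilityTheory

noncomputable section

namespace Switch

/-- The queues of an `n × n` input-queued switch: `(i, j)` stores the packets waiting at input
port `i` for output port `j`. -/
abbrev Queue (n : ℕ) : Type := Fin n × Fin n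

variable {n : ℕ}

/-! ### The weighted inner product, the saturated face, the cone and the projection onto it -/

/-- `⟨x, y⟩_c = ∑ c_ij x_ij y_ij`. -/
def cInner (c x y : Queue n → ℝ) : ℝ := ∑ p, c p * x p * y p

/-- The norm of the weighted inner product (for positive weights `c`). -/
def cNorm (c x : Queue n → ℝ) : ℝ := Real.sqrt (cInner c x x)

/-- The vector `e_c^(i)`: entry `1 / c_ij` in row `i`, and `0` in the other rows. -/
def rowVec (c : Queue n → ℝ) (i : Fin n) : Queue n → ℝ :=
  fun p => if p.1 = i then 1 / c p else 0

/-- The vector `ẽ_c^(j)`: entry `1 / c_ij` in column `j`, and `0` in the other columns. -/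
def colVec (c : Queue n → ℝ) (j : Fin n) : Queue n → ℝ :=
  fun p => if p.2 = j then 1 / c p else 0

/-- The face of the capacity region on which all input and output ports are saturated. -/
def face (c : Queue n → ℝ) : Set (Queue n → ℝ) :=
  {x | (∀ p, 0 ≤ x p) ∧ (∀ i, cInner c x (rowVec c i) = 1) ∧
    ∀ j, cInner c x (colVec c j) = 1}

/-- The cone `K_c` spanned by the vectors `e_c^(i)` and `ẽ_c^(j)`. -/
def cone (c : Queue n → ℝ) : Set (Queue n → ℝ) :=
  {x | ∃ w v : Fin n → ℝ, (∀ i, 0 ≤ w i) ∧ (∀ j, 0 ≤ v j) ∧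
    ∀ p, x p = (w p.1 + v p.2) / c p}

/-- `y` is a point of the cone nearest to `x` in the weighted norm. -/
def IsConeProj (c x y : Queue n → ℝ) : Prop :=
  y ∈ cone c ∧ ∀ z ∈ cone c, cNorm c (x - y) ≤ cNorm c (x - z)

/-- The projection of `x` onto the cone: the point of the cone nearest to `x` in the weighted norm.
For positive weights it exists and is unique, see `isConeProj_iff`. -/
def coneProj (c x : Queue n → ℝ) : Queue n → ℝ := Classical.epsilon (IsConeProj c x)

/-- The error after projection onto the cone. -/
def conePerp (c x : Queue n → ℝ) : Queue n → ℝ := x - coneProj c x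

lemma cInner_self_nonneg {c : Queue n → ℝ} (hc : ∀ p, 0 < c p) (x : Queue n → ℝ) :
    0 ≤ cInner c x x :=
  Finset.sum_nonneg fun p _ => by
    rw [mul_assoc]; exact mul_nonneg (hc p).le (mul_self_nonneg _)

lemma exists_isConeProj {c : Queue n → ℝ} (hc : ∀ p, 0 < c p) (x : Queue n → ℝ) :
    ∃ y, IsConeProj c x y := by
  let g : (Fin n → ℝ) × (Fin n → ℝ) → Queue n → ℝ := fun w p => (w.1 p.1 + w.2 p.2) / c p
  let f : (Fin n → ℝ) × (Fin n → ℝ) → ℝ := fun w => cInner c (x - g w) (x - g w)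
  have hterm : ∀ w p, c p * (x p - g w p) ^ 2 ≤ f w := by
    intro w p
    have h := Finset.single_le_sum (f := fun p => c p * (x - g w) p * (x - g w) p)
      (fun p _ => by rw [mul_assoc]; exact mul_nonneg (hc p).le (mul_self_nonneg _))
      (Finset.mem_univ p)
    have h2 : c p * (x p - g w p) ^ 2 = c p * (x - g w) p * (x - g w) p := by
      simp only [Pi.sub_apply]; ring
    rw [h2]; exact h
  have hf0 : 0 ≤ f 0 := cInner_self_nonneg hc _
  let b : Queue n → ℝ := fun p => c p * (|x p| + Real.sqrt (f 0 / c p))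
  have hb : ∀ p, 0 ≤ b p := fun p =>
    mul_nonneg (hc p).le (add_nonneg (abs_nonneg _) (Real.sqrt_nonneg _))
  let B : ℝ := ∑ p, b p
  have hbB : ∀ p, b p ≤ B := fun p =>
    Finset.single_le_sum (f := b) (fun p _ => hb p) (Finset.mem_univ p)
  have hB : 0 ≤ B := Finset.sum_nonneg fun p _ => hb p
  have key : ∀ (w : (Fin n → ℝ) × (Fin n → ℝ)) (p : Queue n), f w ≤ f 0 → w.1 p.1 + w.2 p.2 ≤ B := by
    intro w p hw
    have h1 : (g w p - x p) ^ 2 ≤ f 0 / c p := by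
      rw [le_div_iff₀ (hc p)]
      have := hterm w p
      nlinarith
    have h2 : g w p - x p ≤ Real.sqrt (f 0 / c p) := Real.le_sqrt_of_sq_le h1
    have h3 : g w p ≤ |x p| + Real.sqrt (f 0 / c p) := by
      have := le_abs_self (x p)
      linarith
    have h4 : w.1 p.1 + w.2 p.2 = c p * g w p := by
      have := (hc p).ne'
      simp only [g]; field_simp
    rw [h4]
    exact (mul_le_mul_of_nonneg_left h3 (hc p).le).trans (hbB p)
  let C : Set ((Fin n → ℝ) × (Fin n → ℝ)) :=
    Set.Icc (fun _ => 0) (fun _ => B) ×ˢ Set.Icc (fun _ => 0) (fun _ => B)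
  have hC : IsCompact C := isCompact_Icc.prod isCompact_Icc
  have h0C : (0 : (Fin n → ℝ) × (Fin n → ℝ)) ∈ C :=
    ⟨⟨fun _ => le_rfl, fun _ => hB⟩, ⟨fun _ => le_rfl, fun _ => hB⟩⟩
  have hfc : Continuous f := by
    simp only [f, g, cInner, Pi.sub_apply]
    fun_prop
  obtain ⟨w, hwC, hw⟩ := hC.exists_isMinOn ⟨0, h0C⟩ hfc.continuousOn
  refine ⟨g w, ⟨w.1, w.2, hwC.1.1, hwC.2.1, fun _ => rfl⟩, ?_⟩
  rintro z ⟨u, v, hu, hv, hz⟩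
  have hzg : z = g (u, v) := funext hz
  rw [hzg]
  refine Real.sqrt_le_sqrt ?_
  by_cases h : f (u, v) ≤ f 0
  · refine hw (show (u, v) ∈ C from ⟨⟨hu, fun i => ?_⟩, ⟨hv, fun j => ?_⟩⟩)
    · have := key (u, v) (i, i) h
      have := hv i
      simp only at *
      linarith
    · have := key (u, v) (j, j) h
      have := hu j
      simp only at *
      linarith
  · exact (hw h0C).trans (not_le.1 h).le

lemma IsConeProj.unique {c : Queue n → ℝ} (hc : ∀ p, 0 < c p) {x y z : Queue n → ℝ}
    (hy : IsConeProj c x y) (hz : IsConeProj c x z) : y = z := by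
  have hm : (fun p => (y p + z p) / 2) ∈ cone c := by
    obtain ⟨w, v, hw, hv, hyw⟩ := hy.1
    obtain ⟨w', v', hw', hv', hzw⟩ := hz.1
    refine ⟨fun i => (w i + w' i) / 2, fun j => (v j + v' j) / 2,
      fun i => by have := hw i; have := hw' i; positivity,
      fun j => by have := hv j; have := hv' j; positivity, fun p => ?_⟩
    simp only [hyw, hzw]
    ring
  have h1 := (Real.sqrt_le_sqrt_iff (cInner_self_nonneg hc _)).1 (hy.2 _ hm)
  have h2 := (Real.sqrt_le_sqrt_iff (cInner_self_nonneg hc _)).1 (hz.2 _ hm)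
  have h3 : cInner c (y - z) (y - z) = 2 * cInner c (x - y) (x - y) + 2 * cInner c (x - z) (x - z)
      - 4 * cInner c (x - fun p => (y p + z p) / 2) (x - fun p => (y p + z p) / 2) := by
    simp only [cInner, Finset.mul_sum, ← Finset.sum_add_distrib, ← Finset.sum_sub_distrib,
      Pi.sub_apply]
    exact Finset.sum_congr rfl fun p _ => by ring
  have h4 : cInner c (y - z) (y - z) = 0 :=
    le_antisymm (by linarith) (cInner_self_nonneg hc _)
  funext p
  have h5 := (Finset.sum_eq_zero_iff_of_nonneg (fun p _ => by
    rw [mul_assoc]; exact mul_nonneg (hc p).le (mul_self_nonneg _))).1 h4 p (Finset.mem_univ p)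
  have h6 : (y - z) p = 0 := by
    have := (hc p).ne'
    simpa [this] using h5
  exact sub_eq_zero.1 h6

lemma isConeProj_iff {c : Queue n → ℝ} (hc : ∀ p, 0 < c p) (x y : Queue n → ℝ) :
    IsConeProj c x y ↔ y = coneProj c x := by
  have h : IsConeProj c x (coneProj c x) := Classical.epsilon_spec (exists_isConeProj hc x)
  exact ⟨fun hy => hy.unique hc h, fun hy => hy ▸ h⟩

/-! ### The switch under weighted MaxWeight scheduling -/

/-- The maximal schedules: `0`-`1` vectors with exactly one `1` in each row and each column. -/
def schedules (n : ℕ) : Set (Queue n → ℕ) :=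
  {s | (∀ p, s p = 0 ∨ s p = 1) ∧ (∀ i, ∑ j, s (i, j) = 1) ∧ ∀ j, ∑ i, s (i, j) = 1}

/-- A vector of natural numbers as a real vector. -/
def toReal (q : Queue n → ℕ) : Queue n → ℝ := fun p => (q p : ℝ)

/-- The maximal schedules of maximum weight `⟨q, s⟩_c` when the queue lengths are `q`. -/
def maxWeightSchedules (c : Queue n → ℝ) (q : Queue n → ℕ) : Set (Queue n → ℕ) :=
  {s | s ∈ schedules n ∧
    ∀ s' ∈ schedules n, cInner c (toReal q) (toReal s') ≤ cInner c (toReal q) (toReal s)}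

/-- The unused service at each queue with `q` packets, `a` arrivals and offered service `s`: it is
positive only if there are fewer packets, new arrivals included, than offered service. -/
def unusedService (q a s : Queue n → ℕ) : Queue n → ℕ := fun p => s p - (q p + a p)

/-- The queue lengths `q + a - s + u` at the next time slot (the subtraction never truncates,
see `cast_nextQueue`). -/
def nextQueue (q a s : Queue n → ℕ) : Queue n → ℕ :=
  fun p => q p + a p + unusedService q a s p - s p

lemma cast_nextQueue (q a s : Queue n → ℕ) (p : Queue n) :
    (nextQueue q a s p : ℤ) = q p + a p - s p + unusedService q a s p := by
  simp only [nextQueue, unusedService]; omega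

/-- One time slot of the switch under weighted MaxWeight scheduling, as a Markov kernel on the
vectors of queue lengths. Here `α p` is the law of the number of arrivals to queue `p` in a slot.
Given the queue lengths `q`, the arrivals to the different queues are independent of each other and
of the schedule, and the schedule is uniformly distributed over those of maximum weight. -/
def stepKernel (c : Queue n → ℝ) (α : Queue n → Measure ℕ) :
    Kernel (Queue n → ℕ) (Queue n → ℕ) :=
  Kernel.ofFunOfCountable fun q =>
    ((Measure.pi α).prod (uniformOn (maxWeightSchedules c q))).map
      fun as => nextQueue q as.1 as.2

/-- The laws `α p` of the numbers of arrivals per slot to the queues `p` have means `(1 - ε) ν p`,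
are bounded by `Amax`, and have variances whose vector `(σ_p)_p` of standard deviations satisfies
`‖σ‖² = ∑ σ_p² ≤ σ'²`. -/
structure IsArrivalLaw (ν : Queue n → ℝ) (Amax : ℕ) (σ' ε : ℝ) (α : Queue n → Measure ℕ) :
    Prop where
  isProbabilityMeasure : ∀ p, IsProbabilityMeasure (α p)
  bounded : ∀ p, ∀ᵐ k ∂α p, k ≤ Amax
  mean : ∀ p, ∫ k, (k : ℝ) ∂α p = (1 - ε) * ν p
  variance_le : ∑ p, variance (fun k : ℕ => (k : ℝ)) (α p) ≤ σ' ^ 2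

/-- `π` is a steady-state law of the queue-length process: a stationary probability distribution of
the Markov chain. -/
structure IsSteadyState (c : Queue n → ℝ) (α : Queue n → Measure ℕ) (π : Measure (Queue n → ℕ)) :
    Prop where
  isProbabilityMeasure : IsProbabilityMeasure π
  invariant : (stepKernel c α).Invariant π

end Switch

end

/-!
Write `W` for the weighted distance `‖q_⊥‖_c` of the queue lengths `q` to the cone. The proof is a
Foster–Lyapunov argument with the test function `exp (θ W)` for a small `θ > 0`.

The drift of `W` is read off from `‖q' - q_∥‖_c ^ 2`, which bounds the next `W ^ 2` because `q_∥` is a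
point of the cone. Up to a bounded term it exceeds `W ^ 2` by twice the inner product of `q_⊥` with
the increment `a - s + u`.
* The unused service `u` contributes a nonpositive amount: it lives on empty queues, where
  `q_⊥ = -q_∥ ≤ 0` (`Switch.cInner_conePerp_nextQueue_sub_le`).
* The schedule `s` contributes `⟨q_⊥, ν - s⟩ ≤ -t W` (`Switch.cInner_conePerp_sub_le`). Since `ν` and
  `s` have equal row and column sums, `q_⊥` may be replaced by `q` on the left. The error `q_⊥` is in
  the polar cone, that is, its row and column sums are nonpositive, so `ν + t q_⊥ / W` is doubly
  substochastic for small `t`; by Birkhoff's theorem its weight is at most that of `s`, and it exceeds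
  the weight of `ν` by `t ⟨q, q_⊥⟩ / W = t W`.
* The arrivals contribute `⟨q_⊥, a - ν⟩`, with mean `-ε ⟨q_⊥, ν⟩ ≤ ε ‖ν‖_c W`, which is at most half
  of the gain from the schedule when `ε` is small.

So `W` has negative drift away from `0`, uniformly in `ε`, and its increments are bounded; hence
`E exp (θ W') ≤ ρ exp (θ W) + L` with `ρ < 1`. A truncation argument
(`ProbabilityTheory.Kernel.Invariant.lintegral_le_of_drift`) turns this into a bound on the
exponential moment under every stationary distribution, without integrability assumptions, and the
exponential moment bounds all moments.
-/

/-! ### The weighted inner product -/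

namespace Switch

variable {n : ℕ}

/-- Coordinatewise multiplication by `√c_p`, which is an isometry from the weighted norm to the
Euclidean norm. -/
noncomputable def scaled (c x : Queue n → ℝ) : EuclideanSpace ℝ (Queue n) :=
  WithLp.toLp 2 fun p => Real.sqrt (c p) * x p

lemma cInner_eq_inner {c : Queue n → ℝ} (hc : ∀ p, 0 < c p) (x y : Queue n → ℝ) :
    cInner c x y = inner ℝ (scaled c x) (scaled c y) := by
  simp only [cInner, scaled, PiLp.inner_apply, RCLike.inner_apply, conj_trivial]
  refine Finset.sum_congr rfl fun p _ => ?_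
  have := Real.mul_self_sqrt (hc p).le
  linear_combination -(x p * y p) * this

lemma cNorm_eq_norm {c : Queue n → ℝ} (hc : ∀ p, 0 < c p) (x : Queue n → ℝ) :
    cNorm c x = ‖scaled c x‖ := by
  rw [cNorm, cInner_eq_inner hc, real_inner_self_eq_norm_sq, Real.sqrt_sq (norm_nonneg _)]

lemma cNorm_sq {c : Queue n → ℝ} (hc : ∀ p, 0 < c p) (x : Queue n → ℝ) :
    cNorm c x ^ 2 = cInner c x x :=
  Real.sq_sqrt (cInner_self_nonneg hc x)

lemma cNorm_nonneg (c x : Queue n → ℝ) : 0 ≤ cNorm c x := Real.sqrt_nonneg _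

lemma abs_cInner_le {c : Queue n → ℝ} (hc : ∀ p, 0 < c p) (x y : Queue n → ℝ) :
    |cInner c x y| ≤ cNorm c x * cNorm c y := by
  rw [cInner_eq_inner hc, cNorm_eq_norm hc, cNorm_eq_norm hc]
  exact abs_real_inner_le_norm _ _

lemma cNorm_add_le {c : Queue n → ℝ} (hc : ∀ p, 0 < c p) (x y : Queue n → ℝ) :
    cNorm c (x + y) ≤ cNorm c x + cNorm c y := by
  have h : scaled c (x + y) = scaled c x + scaled c y := by
    ext p; simp [scaled, mul_add]
  rw [cNorm_eq_norm hc, cNorm_eq_norm hc, cNorm_eq_norm hc, h]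
  exact norm_add_le _ _

lemma cNorm_neg (c x : Queue n → ℝ) : cNorm c (-x) = cNorm c x := by
  simp [cNorm, cInner]

lemma cInner_add_right (c x y z : Queue n → ℝ) :
    cInner c x (y + z) = cInner c x y + cInner c x z := by
  simp [cInner, mul_add, Finset.sum_add_distrib]

lemma cInner_sub_right (c x y z : Queue n → ℝ) :
    cInner c x (y - z) = cInner c x y - cInner c x z := by
  simp [cInner, mul_sub, Finset.sum_sub_distrib]

lemma cInner_add_left (c x y z : Queue n → ℝ) :
    cInner c (x + y) z = cInner c x z + cInner c y z := by
  simp [cInner, mul_add, add_mul, Finset.sum_add_distrib]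

lemma cInner_smul_right (c x y : Queue n → ℝ) (t : ℝ) :
    cInner c x (t • y) = t * cInner c x y := by
  simp only [cInner, Finset.mul_sum, Pi.smul_apply, smul_eq_mul]
  exact Finset.sum_congr rfl fun p _ => by ring

lemma cInner_comm (c x y : Queue n → ℝ) : cInner c x y = cInner c y x :=
  Finset.sum_congr rfl fun p _ => by ring

lemma cNorm_add_sq {c : Queue n → ℝ} (hc : ∀ p, 0 < c p) (x y : Queue n → ℝ) :
    cNorm c (x + y) ^ 2 = cNorm c x ^ 2 + 2 * cInner c x y + cNorm c y ^ 2 := by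
  rw [cNorm_sq hc, cNorm_sq hc, cNorm_sq hc, cInner_add_left, cInner_add_right, cInner_add_right,
    cInner_comm c y x]
  ring

lemma cNorm_le_of_abs_le {c : Queue n → ℝ} (hc : ∀ p, 0 < c p) {x : Queue n → ℝ} {b : ℝ}
    (hx : ∀ p, |x p| ≤ b) : cNorm c x ≤ Real.sqrt (∑ p, c p * b ^ 2) := by
  refine Real.sqrt_le_sqrt (Finset.sum_le_sum fun p _ => ?_)
  rw [mul_assoc, ← sq, ← sq_abs (x p)]
  have := hc p
  gcongr
  exact hx p

lemma sqrt_mul_abs_le_cNorm {c : Queue n → ℝ} (hc : ∀ p, 0 < c p) (x : Queue n → ℝ)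
    (p : Queue n) : Real.sqrt (c p) * |x p| ≤ cNorm c x := by
  have h := PiLp.norm_apply_le (scaled c x) p
  rw [cNorm_eq_norm hc]
  simpa [scaled, abs_mul, abs_of_nonneg (Real.sqrt_nonneg _)] using h

/-! ### Projection onto the cone -/

lemma coneProj_mem {c : Queue n → ℝ} (hc : ∀ p, 0 < c p) (x : Queue n → ℝ) :
    coneProj c x ∈ cone c := ((isConeProj_iff hc x _).2 rfl).1

lemma cNorm_conePerp_le {c : Queue n → ℝ} (hc : ∀ p, 0 < c p) (x : Queue n → ℝ)
    {y : Queue n → ℝ} (hy : y ∈ cone c) : cNorm c (conePerp c x) ≤ cNorm c (x - y) :=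
  ((isConeProj_iff hc x _).2 rfl).2 y hy

lemma smul_mem_cone {c x : Queue n → ℝ} (hx : x ∈ cone c) {t : ℝ} (ht : 0 ≤ t) :
    t • x ∈ cone c := by
  obtain ⟨w, v, hw, hv, h⟩ := hx
  refine ⟨fun i => t * w i, fun j => t * v j, fun i => mul_nonneg ht (hw i),
    fun j => mul_nonneg ht (hv j), fun p => ?_⟩
  simp only [Pi.smul_apply, smul_eq_mul, h]
  ring

lemma add_mem_cone {c x y : Queue n → ℝ} (hx : x ∈ cone c) (hy : y ∈ cone c) :
    x + y ∈ cone c := by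
  obtain ⟨w, v, hw, hv, h⟩ := hx
  obtain ⟨w', v', hw', hv', h'⟩ := hy
  refine ⟨fun i => w i + w' i, fun j => v j + v' j, fun i => add_nonneg (hw i) (hw' i),
    fun j => add_nonneg (hv j) (hv' j), fun p => ?_⟩
  simp only [Pi.add_apply, h, h']
  ring

/-- First-order optimality of the projection: a direction `y` along which the cone can be followed
from `coneProj c x` makes a nonpositive inner product with the error. -/
lemma cInner_conePerp_nonpos_of_feasible {c : Queue n → ℝ} (hc : ∀ p, 0 < c p)
    (x y : Queue n → ℝ) (hy : ∀ t : ℝ, 0 < t → t ≤ 1 → coneProj c x + t • y ∈ cone c) :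
    cInner c (conePerp c x) y ≤ 0 := by
  have h : ∀ t : ℝ, 0 < t → t ≤ 1 →
      2 * cInner c (conePerp c x) y ≤ t * cNorm c y ^ 2 := by
    intro t ht ht1
    have h1 := cNorm_conePerp_le hc x (hy t ht ht1)
    have h2 : x - (coneProj c x + t • y) = conePerp c x + (-t) • y := by
      rw [conePerp, neg_smul]; abel
    have h3 := pow_le_pow_left₀ (cNorm_nonneg c _) h1 2
    rw [h2, cNorm_add_sq hc, cInner_smul_right, cNorm_sq hc ((-t) • y), cInner_smul_right,
      cInner_comm c ((-t) • y), cInner_smul_right, ← cNorm_sq hc y] at h3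
    have h4 : t * (2 * cInner c (conePerp c x) y) ≤ t * (t * cNorm c y ^ 2) := by nlinarith
    exact le_of_mul_le_mul_left h4 ht
  by_contra! hpos
  set a := cInner c (conePerp c x) y
  have hb : 0 ≤ cNorm c y ^ 2 := sq_nonneg _
  have h1 := h (min 1 (a / (cNorm c y ^ 2 + 1))) (by positivity) (min_le_left _ _)
  have h2 : min 1 (a / (cNorm c y ^ 2 + 1)) * (cNorm c y ^ 2 + 1) ≤ a := by
    calc _ ≤ a / (cNorm c y ^ 2 + 1) * (cNorm c y ^ 2 + 1) := by gcongr; exact min_le_right _ _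
      _ = a := by field_simp
  have h3 : 0 < min 1 (a / (cNorm c y ^ 2 + 1)) := by positivity
  nlinarith

/-- The error lies in the polar cone. -/
lemma cInner_conePerp_nonpos {c : Queue n → ℝ} (hc : ∀ p, 0 < c p) (x : Queue n → ℝ)
    {y : Queue n → ℝ} (hy : y ∈ cone c) : cInner c (conePerp c x) y ≤ 0 :=
  cInner_conePerp_nonpos_of_feasible hc x y fun _ ht _ =>
    add_mem_cone (coneProj_mem hc x) (smul_mem_cone hy ht.le)

lemma cInner_conePerp_coneProj {c : Queue n → ℝ} (hc : ∀ p, 0 < c p) (x : Queue n → ℝ) :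
    cInner c (conePerp c x) (coneProj c x) = 0 := by
  refine le_antisymm (cInner_conePerp_nonpos hc x (coneProj_mem hc x)) ?_
  have h := cInner_conePerp_nonpos_of_feasible hc x ((-1 : ℝ) • coneProj c x) fun t _ ht1 => by
    have h1 : coneProj c x + t • (-1 : ℝ) • coneProj c x = (1 - t) • coneProj c x := by
      rw [smul_smul, sub_smul, one_smul, mul_neg_one, neg_smul, sub_eq_add_neg]
    rw [h1]
    exact smul_mem_cone (coneProj_mem hc x) (sub_nonneg.2 ht1)
  rw [cInner_smul_right] at h
  linarith

lemma cInner_self_conePerp {c : Queue n → ℝ} (hc : ∀ p, 0 < c p) (x : Queue n → ℝ) :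
    cInner c x (conePerp c x) = cNorm c (conePerp c x) ^ 2 := by
  have h : cInner c x (conePerp c x) =
      cInner c (conePerp c x) (conePerp c x) + cInner c (coneProj c x) (conePerp c x) := by
    rw [← cInner_add_left, conePerp, sub_add_cancel]
  rw [h, cInner_comm c (coneProj c x), cInner_conePerp_coneProj hc, add_zero, cNorm_sq hc]

lemma coneProj_nonneg {c : Queue n → ℝ} (hc : ∀ p, 0 < c p) (x : Queue n → ℝ) (p : Queue n) :
    0 ≤ coneProj c x p := by
  obtain ⟨w, v, hw, hv, h⟩ := coneProj_mem hc x
  rw [h]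
  exact div_nonneg (add_nonneg (hw _) (hv _)) (hc p).le

/-- The distance to the cone is 1-Lipschitz. -/
lemma cNorm_conePerp_le_add {c : Queue n → ℝ} (hc : ∀ p, 0 < c p) (x y : Queue n → ℝ) :
    cNorm c (conePerp c x) ≤ cNorm c (conePerp c y) + cNorm c (x - y) := by
  refine (cNorm_conePerp_le hc x (coneProj_mem hc y)).trans ?_
  have h : x - coneProj c y = conePerp c y + (x - y) := by rw [conePerp]; abel
  rw [h]
  exact cNorm_add_le hc _ _

lemma abs_cNorm_conePerp_sub_le {c : Queue n → ℝ} (hc : ∀ p, 0 < c p) (x y : Queue n → ℝ) :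
    |cNorm c (conePerp c x) - cNorm c (conePerp c y)| ≤ cNorm c (x - y) := by
  have h1 := cNorm_conePerp_le_add hc x y
  have h2 := cNorm_conePerp_le_add hc y x
  rw [← neg_sub, cNorm_neg] at h2
  rw [abs_le]
  constructor <;> linarith

/-- Comparing with the point of the cone nearest to `x` bounds the squared distance of `x + d`. -/
lemma cNorm_conePerp_add_sq_le {c : Queue n → ℝ} (hc : ∀ p, 0 < c p) (x d : Queue n → ℝ) :
    cNorm c (conePerp c (x + d)) ^ 2 ≤
      cNorm c (conePerp c x) ^ 2 + 2 * cInner c (conePerp c x) d + cNorm c d ^ 2 := by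
  rw [← cNorm_add_sq hc]
  refine pow_le_pow_left₀ (cNorm_nonneg c _) ?_ 2
  have h : conePerp c x + d = x + d - coneProj c x := by rw [conePerp]; abel
  rw [h]
  exact cNorm_conePerp_le hc _ (coneProj_mem hc x)

lemma rowVec_mem_cone (c : Queue n → ℝ) (i : Fin n) : rowVec c i ∈ cone c :=
  ⟨fun k => if k = i then 1 else 0, fun _ => 0, fun k => by dsimp only; split_ifs <;> norm_num,
    fun _ => le_rfl, fun p => by simp only [rowVec]; split_ifs <;> simp⟩

lemma colVec_mem_cone (c : Queue n → ℝ) (j : Fin n) : colVec c j ∈ cone c :=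
  ⟨fun _ => 0, fun k => if k = j then 1 else 0, fun _ => le_rfl,
    fun k => by dsimp only; split_ifs <;> norm_num,
    fun p => by simp only [colVec]; split_ifs <;> simp⟩

lemma cInner_rowVec {c : Queue n → ℝ} (hc : ∀ p, 0 < c p) (x : Queue n → ℝ) (i : Fin n) :
    cInner c x (rowVec c i) = ∑ j, x (i, j) := by
  have h : ∀ p, c p * x p * rowVec c i p = if p.1 = i then x p else 0 := fun p => by
    have := (hc p).ne'
    simp only [rowVec]; split_ifs
    · field_simp
    · simp
  simp only [cInner, h, Fintype.sum_prod_type]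
  rw [Finset.sum_eq_single i (fun b _ hb => by simp [hb]) (by simp)]
  simp

lemma cInner_colVec {c : Queue n → ℝ} (hc : ∀ p, 0 < c p) (x : Queue n → ℝ) (j : Fin n) :
    cInner c x (colVec c j) = ∑ i, x (i, j) := by
  have h : ∀ p, c p * x p * colVec c j p = if p.2 = j then x p else 0 := fun p => by
    have := (hc p).ne'
    simp only [colVec]; split_ifs
    · field_simp
    · simp
  simp only [cInner, h, Fintype.sum_prod_type_right]
  rw [Finset.sum_eq_single j (fun b _ hb => by simp [hb]) (by simp)]
  simp

/-- Elements of the cone cannot tell apart two matrices with equal row and column sums. -/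
lemma cInner_coneProj_eq {c : Queue n → ℝ} (hc : ∀ p, 0 < c p) (q : Queue n → ℝ)
    {x y : Queue n → ℝ} (hr : ∀ i, ∑ j, x (i, j) = ∑ j, y (i, j))
    (hl : ∀ j, ∑ i, x (i, j) = ∑ i, y (i, j)) :
    cInner c (coneProj c q) x = cInner c (coneProj c q) y := by
  obtain ⟨w, v, -, -, h⟩ := coneProj_mem hc q
  have key : ∀ x : Queue n → ℝ, cInner c (coneProj c q) x =
      ∑ i, w i * ∑ j, x (i, j) + ∑ j, v j * ∑ i, x (i, j) := fun x => by
    have h1 : ∀ p, c p * coneProj c q p * x p = w p.1 * x p + v p.2 * x p := fun p => by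
      have := (hc p).ne'
      rw [h]; field_simp
    simp only [cInner, h1, Finset.sum_add_distrib, Finset.mul_sum]
    rw [Fintype.sum_prod_type, Fintype.sum_prod_type_right (fun p : Queue n => v p.2 * x p)]
  rw [key, key]
  simp only [hr, hl]

/-! ### Maximum-weight schedules -/

lemma finite_schedules (n : ℕ) : (schedules n).Finite :=
  (Set.Finite.pi' fun _ : Queue n => (Set.toFinite ({0, 1} : Set ℕ))).subset
    fun _ hs p => hs.1 p

/-- The schedule that serves the queues `(i, σ i)`. -/
def permSchedule (σ : Equiv.Perm (Fin n)) : Queue n → ℕ := fun p => if σ p.1 = p.2 then 1 else 0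

lemma permSchedule_mem (σ : Equiv.Perm (Fin n)) : permSchedule σ ∈ schedules n := by
  refine ⟨fun p => ?_, fun i => ?_, fun j => ?_⟩
  · simp only [permSchedule]; split_ifs <;> simp
  · simp [permSchedule]
  · simp [permSchedule, ← Equiv.eq_symm_apply]

lemma maxWeightSchedules_nonempty (c : Queue n → ℝ) (q : Queue n → ℕ) :
    (maxWeightSchedules c q).Nonempty := by
  obtain ⟨s, hs, h⟩ := Set.exists_max_image (schedules n)
    (fun s => cInner c (toReal q) (toReal s)) (finite_schedules n) ⟨_, permSchedule_mem 1⟩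
  exact ⟨s, hs, h⟩

lemma finite_maxWeightSchedules (c : Queue n → ℝ) (q : Queue n → ℕ) :
    (maxWeightSchedules c q).Finite :=
  (finite_schedules n).subset fun _ hs => hs.1

/-- By Birkhoff's theorem a maximum-weight schedule also beats all doubly stochastic matrices. -/
lemma cInner_le_of_doublyStochastic {c : Queue n → ℝ} {q s : Queue n → ℕ}
    (hs : s ∈ maxWeightSchedules c q) {x : Queue n → ℝ} (hx : ∀ p, 0 ≤ x p)
    (hr : ∀ i, ∑ j, x (i, j) = 1) (hl : ∀ j, ∑ i, x (i, j) = 1) :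
    cInner c (toReal q) x ≤ cInner c (toReal q) (toReal s) := by
  have hM : (Matrix.of fun i j => x (i, j)) ∈ doublyStochastic ℝ (Fin n) :=
    mem_doublyStochastic_iff_sum.2 ⟨fun i j => hx (i, j), hr, hl⟩
  obtain ⟨w, hw, hw1, h⟩ := exists_eq_sum_perm_of_mem_doublyStochastic hM
  have hxs : ∀ p, x p = ∑ σ, w σ * toReal (permSchedule σ) p := fun p => by
    have := congrFun (congrFun h p.1) p.2
    simp only [Matrix.sum_apply, Matrix.of_apply, Matrix.smul_apply, smul_eq_mul] at this
    rw [← Prod.mk.eta (p := p), ← this]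
    refine Finset.sum_congr rfl fun σ _ => ?_
    simp [toReal, permSchedule, PEquiv.toMatrix_apply, Equiv.toPEquiv_apply]
  have h2 : cInner c (toReal q) x = ∑ σ, w σ * cInner c (toReal q) (toReal (permSchedule σ)) := by
    simp only [cInner, hxs, Finset.mul_sum]
    rw [Finset.sum_comm]
    exact Finset.sum_congr rfl fun σ _ => Finset.sum_congr rfl fun p _ => by ring
  rw [h2]
  calc _ ≤ ∑ σ, w σ * cInner c (toReal q) (toReal s) :=
        Finset.sum_le_sum fun σ _ => mul_le_mul_of_nonneg_left (hs.2 _ (permSchedule_mem σ)) (hw σ)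
    _ = _ := by rw [← Finset.sum_mul, hw1, one_mul]

/-- A maximum-weight schedule beats all doubly substochastic matrices: the weights are nonnegative,
and adding `r_i d_j / ∑ r` to the entries, where `r` and `d` are the row and the column deficits,
makes the matrix doubly stochastic. -/
lemma cInner_le_of_substochastic {c : Queue n → ℝ} (hc : ∀ p, 0 < c p) {q s : Queue n → ℕ}
    (hs : s ∈ maxWeightSchedules c q) {x : Queue n → ℝ} (hx : ∀ p, 0 ≤ x p)
    (hr : ∀ i, ∑ j, x (i, j) ≤ 1) (hl : ∀ j, ∑ i, x (i, j) ≤ 1) :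
    cInner c (toReal q) x ≤ cInner c (toReal q) (toReal s) := by
  set r : Fin n → ℝ := fun i => 1 - ∑ j, x (i, j) with hrdef
  set d : Fin n → ℝ := fun j => 1 - ∑ i, x (i, j) with hddef
  have hr0 : ∀ i, 0 ≤ r i := fun i => sub_nonneg.2 (hr i)
  have hd0 : ∀ j, 0 ≤ d j := fun j => sub_nonneg.2 (hl j)
  have hrd : ∑ j, d j = ∑ i, r i := by
    simp only [hrdef, hddef, Finset.sum_sub_distrib]
    rw [Finset.sum_comm]
  have hR : 0 ≤ ∑ i, r i := Finset.sum_nonneg fun i _ => hr0 i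
  have hadd : ∀ p : Queue n, 0 ≤ r p.1 * d p.2 / ∑ i, r i := fun p =>
    div_nonneg (mul_nonneg (hr0 _) (hd0 _)) hR
  -- If the total deficit is `0`, the quotients below are `0`, as are all the deficits.
  have hquot : ∀ a, 0 ≤ a → a ≤ ∑ i, r i → a * (∑ i, r i) / ∑ i, r i = a := fun a ha ha' => by
    rcases hR.eq_or_lt with h | h
    · rw [← h] at ha' ⊢
      simp [le_antisymm ha' ha]
    · field_simp
  refine le_trans ?_ (cInner_le_of_doublyStochastic hs
    (x := fun p => x p + r p.1 * d p.2 / ∑ i, r i) (fun p => add_nonneg (hx p) (hadd p))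
    (fun i => ?_) fun j => ?_)
  · refine Finset.sum_le_sum fun p _ => ?_
    have : 0 ≤ c p * toReal q p := mul_nonneg (hc p).le (Nat.cast_nonneg _)
    exact mul_le_mul_of_nonneg_left (le_add_of_nonneg_right (hadd p)) this
  · dsimp only
    rw [Finset.sum_add_distrib, ← Finset.sum_div, ← Finset.mul_sum, hrd, hquot _ (hr0 i)
      (Finset.single_le_sum (fun i _ => hr0 i) (Finset.mem_univ i))]
    simp [hrdef]
  · dsimp only
    rw [Finset.sum_add_distrib, ← Finset.sum_div, ← Finset.sum_mul, mul_comm, hquot _ (hd0 j)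
      (hrd ▸ Finset.single_le_sum (fun i _ => hd0 i) (Finset.mem_univ j))]
    simp [hddef]

/-- Weight gained by a maximum-weight schedule over `ν`: moving from `ν` by the amount `t` in the direction of the error
leaves the row and column sums at most `1`, because the error is in the polar cone, and gains the
weight `t ‖q_⊥‖`, because the error is orthogonal to the projection. -/
lemma cInner_conePerp_sub_le {c : Queue n → ℝ} (hc : ∀ p, 0 < c p) {ν : Queue n → ℝ}
    (hν : ν ∈ face c) {t : ℝ} (ht : 0 ≤ t) (htν : ∀ p, t ≤ ν p * Real.sqrt (c p))
    {q s : Queue n → ℕ} (hs : s ∈ maxWeightSchedules c q) :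
    cInner c (conePerp c (toReal q)) (ν - toReal s) ≤
      -t * cNorm c (conePerp c (toReal q)) := by
  obtain ⟨hν0, hνr, hνl⟩ := hν
  set z := conePerp c (toReal q) with hz
  rcases (cNorm_nonneg c z).eq_or_lt with h0 | h0
  · have := (le_abs_self _).trans (abs_cInner_le hc z (ν - toReal s))
    rw [← h0] at this ⊢
    simpa using this
  have hk : 0 ≤ t / cNorm c z := div_nonneg ht h0.le
  have hsr : ∀ i, ∑ j, toReal s (i, j) = 1 := fun i => by
    simp only [toReal]; exact_mod_cast hs.1.2.1 i
  have hsl : ∀ j, ∑ i, toReal s (i, j) = 1 := fun j => by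
    simp only [toReal]; exact_mod_cast hs.1.2.2 j
  simp only [cInner_rowVec hc] at hνr
  simp only [cInner_colVec hc] at hνl
  have hzr : ∀ i, ∑ j, z (i, j) ≤ 0 := fun i => by
    rw [← cInner_rowVec hc]; exact cInner_conePerp_nonpos hc _ (rowVec_mem_cone c i)
  have hzl : ∀ j, ∑ i, z (i, j) ≤ 0 := fun j => by
    rw [← cInner_colVec hc]; exact cInner_conePerp_nonpos hc _ (colVec_mem_cone c j)
  have h1 := cInner_le_of_substochastic hc hs (x := ν + (t / cNorm c z) • z) (fun p => ?_)
    (fun i => ?_) (fun j => ?_)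
  · have h2 : cInner c (toReal q) (ν - toReal s) = cInner c z (ν - toReal s) := by
      have h3 : toReal q = z + coneProj c (toReal q) := by rw [hz, conePerp, sub_add_cancel]
      conv_lhs => rw [h3]
      rw [cInner_add_left, cInner_sub_right c (coneProj c _),
        cInner_coneProj_eq hc _ (x := ν) (y := toReal s) (fun i => by rw [hνr, hsr])
          (fun j => by rw [hνl, hsl]), sub_self, add_zero]
    rw [cInner_add_right, cInner_smul_right, hz, cInner_self_conePerp hc, ← hz] at h1
    rw [← h2, cInner_sub_right]
    have h4 : t / cNorm c z * cNorm c z ^ 2 = t * cNorm c z := by field_simp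
    linarith
  · have h2 := sqrt_mul_abs_le_cNorm hc z p
    have h3 := htν p
    have h5 : t / cNorm c z * |z p| ≤ ν p := by
      rw [div_mul_eq_mul_div, div_le_iff₀ h0]
      calc t * |z p| ≤ ν p * Real.sqrt (c p) * |z p| := by gcongr
        _ = ν p * (Real.sqrt (c p) * |z p|) := by ring
        _ ≤ ν p * cNorm c z := by have := hν0 p; gcongr
    have h6 := mul_le_mul_of_nonneg_left (neg_abs_le (z p)) hk
    simp only [Pi.add_apply, Pi.smul_apply, smul_eq_mul]
    linarith
  · simp only [Pi.add_apply, Pi.smul_apply, smul_eq_mul, Finset.sum_add_distrib, hνr,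
      ← Finset.mul_sum]
    have := mul_nonpos_of_nonneg_of_nonpos hk (hzr i)
    linarith
  · simp only [Pi.add_apply, Pi.smul_apply, smul_eq_mul, Finset.sum_add_distrib, hνl,
      ← Finset.mul_sum]
    have := mul_nonpos_of_nonneg_of_nonpos hk (hzl j)
    linarith

end Switch

/-! ### Foster–Lyapunov bound for stationary distributions -/

open scoped ENNReal in
/-- If `∫ V dκ(x) ≤ ρ V(x) + L` with `ρ = 1 - η < 1`, then `∫ V dπ ≤ L / η` for every stationary
probability distribution `π`. Integrability of `V` is not assumed: stationarity is applied to
`min V m` only, and `η V ≤ L + min V m - min (ρ V + L) m` wherever `V ≤ m`. -/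
lemma ProbabilityTheory.Kernel.Invariant.lintegral_le_of_drift {X : Type*} [MeasurableSpace X]
    {κ : Kernel X X} [IsMarkovKernel κ] {π : Measure X} [IsProbabilityMeasure π]
    (hπ : κ.Invariant π) {V : X → ℝ≥0∞} (hV : Measurable V) (hVfin : ∀ x, V x ≠ ⊤)
    {ρ η L : ℝ≥0∞} (hρη : ρ + η = 1)
    (hdrift : ∀ x, ∫⁻ y, V y ∂κ x ≤ ρ * V x + L) : η * ∫⁻ x, V x ∂π ≤ L := by
  have hstep : ∀ m : ℕ, ∫⁻ x, min (V x) m ∂π ≤ ∫⁻ x, min (ρ * V x + L) m ∂π := by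
    intro m
    conv_lhs => rw [← hπ.def]
    rw [Measure.lintegral_bind κ.aemeasurable (hV.min measurable_const).aemeasurable]
    refine lintegral_mono fun x => le_min ?_ ?_
    · exact (lintegral_mono fun y => min_le_left _ _).trans (hdrift x)
    · exact (lintegral_mono fun y => min_le_right _ _).trans (by simp)
  have hind : ∀ m : ℕ, Measurable ({x | V x ≤ m}.indicator V) := fun m =>
    hV.indicator (measurableSet_le hV measurable_const)
  have hm : ∀ m : ℕ, η * ∫⁻ x, {x | V x ≤ m}.indicator V x ∂π ≤ L := by
    intro m
    have hpt : ∀ x, min (ρ * V x + L) m + η * {x | V x ≤ m}.indicator V x ≤ min (V x) m + L := by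
      intro x
      by_cases h : V x ≤ m
      · rw [Set.indicator_of_mem (show x ∈ {x | V x ≤ m} from h), min_eq_left h]
        calc _ ≤ ρ * V x + L + η * V x := by gcongr; exact min_le_left _ _
          _ = (ρ + η) * V x + L := by ring
          _ = V x + L := by rw [hρη, one_mul]
      · rw [Set.indicator_of_notMem (show x ∉ {x | V x ≤ m} from h),
          min_eq_right (not_le.1 h).le, mul_zero, add_zero]
        exact (min_le_right _ _).trans le_self_add
    have hint := lintegral_mono (μ := π) hpt
    rw [lintegral_add_left (by fun_prop), lintegral_add_right _ measurable_const,
      lintegral_const_mul _ (hind m), MeasureTheory.lintegral_const, measure_univ, mul_one] at hint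
    have hfin : ∫⁻ x, min (ρ * V x + L) m ∂π ≠ ⊤ := by
      refine ne_top_of_le_ne_top (ENNReal.natCast_ne_top m) ?_
      exact (lintegral_mono fun y => min_le_right _ _).trans (by simp)
    exact (ENNReal.add_le_add_iff_left hfin).1 (hint.trans (add_le_add_left (hstep m) L))
  have hsup : ∀ x, V x = ⨆ m : ℕ, {x | V x ≤ m}.indicator V x := by
    intro x
    refine le_antisymm ?_ (iSup_le fun m => Set.indicator_le_self _ _ x)
    obtain ⟨m, h⟩ := ENNReal.exists_nat_gt (hVfin x)
    refine le_iSup_of_le m ?_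
    rw [Set.indicator_of_mem (show x ∈ {x | V x ≤ m} from h.le)]
  have hmono : Monotone fun (m : ℕ) => {x | V x ≤ m}.indicator V := by
    intro m k hmk x
    refine Set.indicator_le_indicator_of_subset (fun y hy => ?_) (fun _ => zero_le) x
    exact le_trans (show V y ≤ m from hy) (by exact_mod_cast hmk)
  calc η * ∫⁻ x, V x ∂π = η * ∫⁻ x, ⨆ m : ℕ, {x | V x ≤ m}.indicator V x ∂π := by
        rw [← lintegral_congr hsup]
    _ = ⨆ m : ℕ, η * ∫⁻ x, {x | V x ≤ m}.indicator V x ∂π := by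
        rw [lintegral_iSup hind hmono, ENNReal.mul_iSup]
    _ ≤ L := iSup_le hm

namespace Switch

variable {n : ℕ}

/-! ### One time slot of the switch -/

/-- The joint law of the arrivals and the schedule in a slot that starts with queue lengths `q`. -/
noncomputable def slotLaw (c : Queue n → ℝ) (α : Queue n → Measure ℕ) (q : Queue n → ℕ) :
    Measure ((Queue n → ℕ) × (Queue n → ℕ)) :=
  (Measure.pi α).prod (uniformOn (maxWeightSchedules c q))

lemma isProbabilityMeasure_slotLaw (c : Queue n → ℝ) (α : Queue n → Measure ℕ)
    [∀ p, IsProbabilityMeasure (α p)] (q : Queue n → ℕ) :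
    IsProbabilityMeasure (slotLaw c α q) := by
  have := isProbabilityMeasure_uniformOn (finite_maxWeightSchedules c q)
    (maxWeightSchedules_nonempty c q)
  unfold slotLaw
  infer_instance

lemma stepKernel_apply (c : Queue n → ℝ) (α : Queue n → Measure ℕ) (q : Queue n → ℕ) :
    stepKernel c α q = (slotLaw c α q).map fun as => nextQueue q as.1 as.2 := rfl

lemma isMarkovKernel_stepKernel (c : Queue n → ℝ) (α : Queue n → Measure ℕ)
    [∀ p, IsProbabilityMeasure (α p)] : IsMarkovKernel (stepKernel c α) := by
  refine ⟨fun q => ?_⟩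
  have := isProbabilityMeasure_slotLaw c α q
  rw [stepKernel_apply]
  exact Measure.isProbabilityMeasure_map (Measurable.of_discrete).aemeasurable

lemma ae_slotLaw_arrivals_le {c ν : Queue n → ℝ} {Amax : ℕ} {σ' ε : ℝ} {α : Queue n → Measure ℕ}
    (hα : IsArrivalLaw ν Amax σ' ε α) (q : Queue n → ℕ) :
    ∀ᵐ as ∂slotLaw c α q, ∀ p, as.1 p ≤ Amax := by
  have := hα.isProbabilityMeasure
  have := isProbabilityMeasure_uniformOn (finite_maxWeightSchedules c q)
    (maxWeightSchedules_nonempty c q)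
  have h : ∀ᵐ a ∂Measure.pi α, ∀ p, a p ≤ Amax :=
    ae_all_iff.2 fun p => Measure.tendsto_eval_ae_ae.eventually (hα.bounded p)
  exact Measure.quasiMeasurePreserving_fst.ae h

lemma ae_slotLaw_mem_maxWeightSchedules (c : Queue n → ℝ) (α : Queue n → Measure ℕ)
    [∀ p, IsProbabilityMeasure (α p)] (q : Queue n → ℕ) :
    ∀ᵐ as ∂slotLaw c α q, as.2 ∈ maxWeightSchedules c q := by
  have := isProbabilityMeasure_uniformOn (finite_maxWeightSchedules c q)
    (maxWeightSchedules_nonempty c q)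
  have h : ∀ᵐ s ∂uniformOn (maxWeightSchedules c q), s ∈ maxWeightSchedules c q :=
    ae_cond_mem MeasurableSet.of_discrete
  exact Measure.quasiMeasurePreserving_snd.ae h

lemma integrable_arrivals {c ν : Queue n → ℝ} {Amax : ℕ} {σ' ε : ℝ} {α : Queue n → Measure ℕ}
    (hα : IsArrivalLaw ν Amax σ' ε α) (q : Queue n → ℕ) (p : Queue n) :
    Integrable (fun as => toReal as.1 p) (slotLaw c α q) := by
  have := hα.isProbabilityMeasure
  have := isProbabilityMeasure_slotLaw c α q
  refine Integrable.of_bound (Measurable.of_discrete).aestronglyMeasurable Amax ?_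
  filter_upwards [ae_slotLaw_arrivals_le hα q] with as h
  simpa [toReal] using h p

lemma integral_arrivals {c ν : Queue n → ℝ} {Amax : ℕ} {σ' ε : ℝ} {α : Queue n → Measure ℕ}
    (hα : IsArrivalLaw ν Amax σ' ε α) (q : Queue n → ℕ) (p : Queue n) :
    ∫ as, toReal as.1 p ∂slotLaw c α q = (1 - ε) * ν p := by
  have := hα.isProbabilityMeasure
  have := isProbabilityMeasure_uniformOn (finite_maxWeightSchedules c q)
    (maxWeightSchedules_nonempty c q)
  have h1 := integral_fun_fst (μ := Measure.pi α) (ν := uniformOn (maxWeightSchedules c q))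
    (fun a => toReal a p)
  have h2 := integral_comp_eval (μ := α) (i := p) (f := fun k : ℕ => (k : ℝ))
    (Measurable.of_discrete).aestronglyMeasurable
  rw [slotLaw, h1, probReal_univ, one_smul, ← hα.mean p, ← h2]
  rfl

lemma integrable_cInner_arrivals {c ν : Queue n → ℝ} {Amax : ℕ} {σ' ε : ℝ}
    {α : Queue n → Measure ℕ} (hα : IsArrivalLaw ν Amax σ' ε α) (q : Queue n → ℕ)
    (z : Queue n → ℝ) :
    Integrable (fun as => cInner c z (toReal as.1)) (slotLaw c α q) :=
  integrable_finsetSum _ fun p _ => (integrable_arrivals hα q p).const_mul _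

lemma integral_cInner_arrivals {c ν : Queue n → ℝ} {Amax : ℕ} {σ' ε : ℝ}
    {α : Queue n → Measure ℕ} (hα : IsArrivalLaw ν Amax σ' ε α) (q : Queue n → ℕ)
    (z : Queue n → ℝ) :
    ∫ as, cInner c z (toReal as.1) ∂slotLaw c α q = (1 - ε) * cInner c z ν := by
  simp only [cInner]
  rw [integral_finsetSum _ fun p _ => (integrable_arrivals hα q p).const_mul _, Finset.mul_sum]
  refine Finset.sum_congr rfl fun p _ => ?_
  rw [integral_const_mul, integral_arrivals hα]
  ring

lemma abs_toReal_nextQueue_sub_le {q a s : Queue n → ℕ} {A : ℕ} (ha : ∀ p, a p ≤ A)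
    (hs : s ∈ schedules n) (p : Queue n) :
    |(toReal (nextQueue q a s) - toReal q) p| ≤ (A + 1 : ℝ) := by
  have h1 := ha p
  have h2 := hs.1 p
  have h3 : (nextQueue q a s p : ℤ) - q p ≤ A + 1 ∧ -(A + 1 : ℤ) ≤ nextQueue q a s p - q p := by
    simp only [nextQueue, unusedService]
    omega
  rw [abs_le]
  simp only [toReal, Pi.sub_apply]
  exact ⟨by exact_mod_cast h3.2, by exact_mod_cast h3.1⟩

/-- Unused service only occurs at empty queues, where the error is nonpositive because the
projection is nonnegative; so it cannot increase the inner product with the error. -/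
lemma cInner_conePerp_nextQueue_sub_le {c : Queue n → ℝ} (hc : ∀ p, 0 < c p)
    {q a s : Queue n → ℕ} (hs : s ∈ schedules n) :
    cInner c (conePerp c (toReal q)) (toReal (nextQueue q a s) - toReal q) ≤
      cInner c (conePerp c (toReal q)) (toReal a - toReal s) := by
  refine Finset.sum_le_sum fun p _ => ?_
  rw [mul_assoc, mul_assoc]
  refine mul_le_mul_of_nonneg_left ?_ (hc p).le
  have h1 : (nextQueue q a s p : ℝ) = q p + a p - s p + unusedService q a s p := by
    exact_mod_cast cast_nextQueue q a s p
  have h2 : conePerp c (toReal q) p * unusedService q a s p ≤ 0 := by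
    have hs := hs.1 p
    by_cases hq : q p = 0
    · refine mul_nonpos_of_nonpos_of_nonneg ?_ (Nat.cast_nonneg _)
      simpa [conePerp, toReal, hq] using coneProj_nonneg hc (toReal q) p
    · have : unusedService q a s p = 0 := by simp only [unusedService]; omega
      simp [this]
  simp only [Pi.sub_apply, toReal, h1]
  linarith

/-! ### Drift of the distance to the cone -/

/-- In a slot that starts at a positive distance from the cone and serves a maximum-weight schedule,
the distance increases by at most an affine function of the arrivals that does not involve the
schedule. So its expectation needs only the mean of the arrivals. -/
lemma cNorm_conePerp_nextQueue_sub_le {c : Queue n → ℝ} (hc : ∀ p, 0 < c p) {ν : Queue n → ℝ}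
    (hν : ν ∈ face c) {t : ℝ} (ht : 0 ≤ t) (htν : ∀ p, t ≤ ν p * Real.sqrt (c p))
    {q a s : Queue n → ℕ} (hs : s ∈ maxWeightSchedules c q) {D : ℝ}
    (hD : cNorm c (toReal (nextQueue q a s) - toReal q) ≤ D)
    (hW : 0 < cNorm c (conePerp c (toReal q))) :
    cNorm c (conePerp c (toReal (nextQueue q a s))) - cNorm c (conePerp c (toReal q)) ≤
      (cInner c (conePerp c (toReal q)) (toReal a) - cInner c (conePerp c (toReal q)) ν) /
        cNorm c (conePerp c (toReal q)) - t + D ^ 2 / (2 * cNorm c (conePerp c (toReal q))) := by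
  have h1 := cNorm_conePerp_add_sq_le hc (toReal q) (toReal (nextQueue q a s) - toReal q)
  rw [add_sub_cancel] at h1
  have h2 := cInner_conePerp_nextQueue_sub_le hc (q := q) (a := a) hs.1
  have h3 := cInner_conePerp_sub_le hc hν ht htν hs
  have h4 := pow_le_pow_left₀ (cNorm_nonneg c _) hD 2
  rw [cInner_sub_right] at h3
  rw [cInner_sub_right c _ (toReal a)] at h2
  set W := cNorm c (conePerp c (toReal q))
  set W' := cNorm c (conePerp c (toReal (nextQueue q a s)))
  set x := cInner c (conePerp c (toReal q)) (toReal a)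
  set y := cInner c (conePerp c (toReal q)) ν
  have h5 : (x - y) / W - t + D ^ 2 / (2 * W) = (2 * (x - y) - 2 * t * W + D ^ 2) / (2 * W) := by
    field_simp
  rw [h5, le_div_iff₀ (by positivity)]
  nlinarith [sq_nonneg (W' - W)]

/-- Negative drift of `exp (θ ‖q_⊥‖_c)` far from the cone. The schedule contributes `-t` to the mean
increment of `‖q_⊥‖_c`, the distance of the arrival rate to the face at most `t / 2`, and the second
order term `D ^ 2 / (2 ‖q_⊥‖_c)` at most `t / 4`, which leaves `-t / 4`. -/
lemma lintegral_exp_le_of_le {c : Queue n → ℝ} (hc : ∀ p, 0 < c p) {ν : Queue n → ℝ}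
    (hν : ν ∈ face c) {Amax : ℕ} {σ' ε : ℝ} {α : Queue n → Measure ℕ}
    (hα : IsArrivalLaw ν Amax σ' ε α) (hε : 0 ≤ ε)
    {t : ℝ} (ht : 0 < t) (htν : ∀ p, t ≤ ν p * Real.sqrt (c p)) (hεt : ε * cNorm c ν ≤ t / 2)
    {D : ℝ} (hD : Real.sqrt (∑ p, c p * ((Amax : ℝ) + 1) ^ 2) ≤ D)
    {θ : ℝ} (hθ : 0 ≤ θ) (hθD : θ * D ≤ 1) (hθt : θ * D ^ 2 ≤ t / 8)
    {q : Queue n → ℕ} (hq0 : 0 < cNorm c (conePerp c (toReal q)))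
    (hq : 2 * D ^ 2 / t ≤ cNorm c (conePerp c (toReal q))) :
    ∫⁻ q', ENNReal.ofReal (Real.exp (θ * cNorm c (conePerp c (toReal q')))) ∂stepKernel c α q ≤
      ENNReal.ofReal ((1 - θ * t / 8) * Real.exp (θ * cNorm c (conePerp c (toReal q)))) := by
  have := hα.isProbabilityMeasure
  have := isProbabilityMeasure_slotLaw c α q
  rw [stepKernel_apply, lintegral_map Measurable.of_discrete Measurable.of_discrete]
  set z := conePerp c (toReal q) with hz
  set W := cNorm c z with hW
  set h : (Queue n → ℕ) × (Queue n → ℕ) → ℝ := fun as => Real.exp (θ * W) *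
    (1 + θ * ((cInner c z (toReal as.1) - cInner c z ν) / W - t + D ^ 2 / (2 * W)) +
      θ ^ 2 * D ^ 2) with hh
  have hpt : ∀ᵐ as ∂slotLaw c α q,
      Real.exp (θ * cNorm c (conePerp c (toReal (nextQueue q as.1 as.2)))) ≤ h as := by
    filter_upwards [ae_slotLaw_arrivals_le hα q,
      ae_slotLaw_mem_maxWeightSchedules c α q] with as ha hs
    have hinc : cNorm c (toReal (nextQueue q as.1 as.2) - toReal q) ≤ D :=
      (cNorm_le_of_abs_le hc (abs_toReal_nextQueue_sub_le ha hs.1)).trans hD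
    have h1 := cNorm_conePerp_nextQueue_sub_le hc hν ht.le htν hs hinc hq0
    have h2 := (abs_cNorm_conePerp_sub_le hc (toReal (nextQueue q as.1 as.2)) (toReal q)).trans hinc
    rw [← hz, ← hW] at h1 h2
    set W' := cNorm c (conePerp c (toReal (nextQueue q as.1 as.2)))
    have h3 : |θ * (W' - W)| ≤ 1 := by
      rw [abs_mul, abs_of_nonneg hθ]
      exact (mul_le_mul_of_nonneg_left h2 hθ).trans hθD
    have h4 := (le_abs_self _).trans (Real.abs_exp_sub_one_sub_id_le h3)
    have h5 : θ * W' = θ * W + θ * (W' - W) := by ring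
    rw [h5, Real.exp_add]
    refine mul_le_mul_of_nonneg_left ?_ (Real.exp_pos _).le
    have h6 : (θ * (W' - W)) ^ 2 ≤ θ ^ 2 * D ^ 2 := by
      rw [mul_pow, ← sq_abs (W' - W)]
      gcongr
    have h7 := mul_le_mul_of_nonneg_left h1 hθ
    linarith
  have hxi := integrable_cInner_arrivals (c := c) hα q z
  have hint : Integrable h (slotLaw c α q) := by
    refine Integrable.const_mul ?_ _
    refine ((integrable_const 1).add (Integrable.const_mul ?_ θ)).add (integrable_const _)
    exact (((hxi.sub (integrable_const _)).div_const W).sub (integrable_const t)).add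
      (integrable_const _)
  have hval : ∫ as, h as ∂slotLaw c α q = Real.exp (θ * W) *
      (1 + θ * (-ε * cInner c z ν / W - t + D ^ 2 / (2 * W)) + θ ^ 2 * D ^ 2) := by
    have h1 : ∀ as, h as = Real.exp (θ * W) * θ / W * cInner c z (toReal as.1) +
        Real.exp (θ * W) * (1 + θ * (-cInner c z ν / W - t + D ^ 2 / (2 * W)) + θ ^ 2 * D ^ 2) :=
      fun as => by simp only [hh]; ring
    simp only [h1]
    rw [integral_add (hxi.const_mul _) (integrable_const _), integral_const_mul, integral_const,
      integral_cInner_arrivals hα, probReal_univ, one_smul]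
    ring
  calc _ ≤ ∫⁻ as, ENNReal.ofReal (h as) ∂slotLaw c α q :=
        lintegral_mono_ae (hpt.mono fun _ h => ENNReal.ofReal_le_ofReal h)
    _ = ENNReal.ofReal (∫ as, h as ∂slotLaw c α q) :=
        (ofReal_integral_eq_lintegral_ofReal hint
          (hpt.mono fun _ h => (Real.exp_pos _).le.trans h)).symm
    _ ≤ _ := by
        refine ENNReal.ofReal_le_ofReal ?_
        rw [hval, mul_comm]
        refine mul_le_mul_of_nonneg_right ?_ (Real.exp_pos _).le
        have h1 : -ε * cInner c z ν / W ≤ t / 2 := by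
          rw [div_le_iff₀ hq0]
          have h2 := (abs_le.1 (abs_cInner_le hc z ν)).1
          nlinarith [mul_le_mul_of_nonneg_left h2 hε, mul_le_mul_of_nonneg_right hεt hq0.le]
        have h2 : D ^ 2 / (2 * W) ≤ t / 4 := by
          rw [div_le_iff₀ ht] at hq
          rw [div_le_iff₀ (by positivity)]
          linarith
        have h3 : θ * (-ε * cInner c z ν / W - t + D ^ 2 / (2 * W)) ≤ θ * (-(t / 4)) :=
          mul_le_mul_of_nonneg_left (by linarith) hθ
        have h4 := mul_le_mul_of_nonneg_left hθt hθ
        linarith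

/-- Near the cone, `exp (θ ‖q_⊥‖_c)` stays bounded after one slot. -/
lemma lintegral_exp_le_of_lt {c : Queue n → ℝ} (hc : ∀ p, 0 < c p) {ν : Queue n → ℝ}
    {Amax : ℕ} {σ' ε : ℝ} {α : Queue n → Measure ℕ}
    (hα : IsArrivalLaw ν Amax σ' ε α)
    {D : ℝ} (hD : Real.sqrt (∑ p, c p * ((Amax : ℝ) + 1) ^ 2) ≤ D)
    {θ K : ℝ} (hθ : 0 ≤ θ) {q : Queue n → ℕ} (hq : cNorm c (conePerp c (toReal q)) ≤ K) :
    ∫⁻ q', ENNReal.ofReal (Real.exp (θ * cNorm c (conePerp c (toReal q')))) ∂stepKernel c α q ≤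
      ENNReal.ofReal (Real.exp (θ * (K + D))) := by
  have := hα.isProbabilityMeasure
  have := isProbabilityMeasure_slotLaw c α q
  rw [stepKernel_apply, lintegral_map Measurable.of_discrete Measurable.of_discrete]
  refine (lintegral_mono_ae (g := fun _ => ENNReal.ofReal (Real.exp (θ * (K + D)))) ?_).trans
    (by simp)
  filter_upwards [ae_slotLaw_arrivals_le hα q,
    ae_slotLaw_mem_maxWeightSchedules c α q] with as ha hs
  have hinc : cNorm c (toReal (nextQueue q as.1 as.2) - toReal q) ≤ D :=
    (cNorm_le_of_abs_le hc (abs_toReal_nextQueue_sub_le ha hs.1)).trans hD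
  have h2 := cNorm_conePerp_le_add hc (toReal (nextQueue q as.1 as.2)) (toReal q)
  refine ENNReal.ofReal_le_ofReal (Real.exp_le_exp.2 (mul_le_mul_of_nonneg_left ?_ hθ))
  linarith

/-! ### Moments in steady state -/

/-- In steady state, the distance to the cone has an exponential moment, bounded uniformly over
the arrival laws close to saturation. -/
lemma exists_lintegral_exp_le (c : Queue n → ℝ) (hc : ∀ p, 0 < c p) {ν : Queue n → ℝ}
    (hν : ν ∈ face c) (hνpos : ∀ p, 0 < ν p) (Amax : ℕ) :
    ∃ ν' θ E : ℝ, 0 < ν' ∧ 0 < θ ∧ 0 ≤ E ∧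
      ∀ (ε σ' : ℝ) (α : Queue n → Measure ℕ) (π : Measure (Queue n → ℕ)), 0 < ε → ε ≤ ν' →
        IsArrivalLaw ν Amax σ' ε α → IsSteadyState c α π →
        ∫⁻ q, ENNReal.ofReal (Real.exp (θ * cNorm c (conePerp c (toReal q)))) ∂π ≤
          ENNReal.ofReal E := by
  obtain ⟨t, ht, ht1, htν⟩ :
      ∃ t : ℝ, 0 < t ∧ t ≤ 1 ∧ ∀ p, t ≤ ν p * Real.sqrt (c p) := by
    have hpos : ∀ p, 0 < ν p * Real.sqrt (c p) := fun p =>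
      mul_pos (hνpos p) (Real.sqrt_pos.2 (hc p))
    obtain ⟨t, ht, h⟩ := Pi.exists_forall_pos_add_lt (x := fun _ => (0 : ℝ)) hpos
    exact ⟨min t 1, by positivity, min_le_right _ _,
      fun p => (min_le_left _ _).trans (by simpa using (h p).le)⟩
  set D : ℝ := Real.sqrt (∑ p, c p * ((Amax : ℝ) + 1) ^ 2)
  have hD0 : 0 ≤ D := Real.sqrt_nonneg _
  set N := cNorm c ν
  have hN : 0 ≤ N := cNorm_nonneg c ν
  -- `θ D ^ 2 ≤ t / 8` keeps the quadratic error of the exponential below half of the drift `-t / 4`.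
  set θ : ℝ := t / (8 * (D + 1) ^ 2) with hθdef
  have hθ : 0 < θ := by positivity
  have hθ' : θ * (D + 1) ^ 2 = t / 8 := by rw [hθdef]; field_simp
  have hθt : θ * D ^ 2 ≤ t / 8 := by rw [← hθ']; gcongr; linarith
  have hθD : θ * D ≤ 1 := by nlinarith
  have hθ1 : θ ≤ 1 := by nlinarith
  have hη : 0 < θ * t / 8 := by positivity
  set K := 2 * D ^ 2 / t + 1
  have hK : 0 < K := by positivity
  refine ⟨t / (2 * (N + 1)), θ, Real.exp (θ * (K + D)) / (θ * t / 8), by positivity, hθ,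
    by positivity, fun ε σ' α π hε hεν hα hπ => ?_⟩
  have := hπ.isProbabilityMeasure
  have := hα.isProbabilityMeasure
  have := isMarkovKernel_stepKernel c α
  have hεt : ε * N ≤ t / 2 := by
    rw [le_div_iff₀ (by positivity)] at hεν
    linarith
  have hdrift := hπ.invariant.lintegral_le_of_drift
    (V := fun q => ENNReal.ofReal (Real.exp (θ * cNorm c (conePerp c (toReal q)))))
    Measurable.of_discrete (fun _ => ENNReal.ofReal_ne_top)
    (ρ := ENNReal.ofReal (1 - θ * t / 8)) (η := ENNReal.ofReal (θ * t / 8))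
    (L := ENNReal.ofReal (Real.exp (θ * (K + D))))
    (by
      rw [← ENNReal.ofReal_add (by nlinarith) hη.le, sub_add_cancel, ENNReal.ofReal_one])
    (fun q => by
      rcases le_total (cNorm c (conePerp c (toReal q))) K with h | h
      · exact (lintegral_exp_le_of_lt hc hα le_rfl hθ.le h).trans le_add_self
      · refine (lintegral_exp_le_of_le hc hν hα hε.le ht htν hεt le_rfl hθ.le hθD hθt
          (hK.trans_le h) ((le_add_of_nonneg_right zero_le_one).trans h)).trans ?_
        rw [← ENNReal.ofReal_mul (by nlinarith)]
        exact le_self_add)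
  rw [ENNReal.ofReal_div_of_pos hη, ENNReal.le_div_iff_mul_le (by simp [hη]) (by simp), mul_comm]
  exact hdrift

lemma norm_toLp_le {c : Queue n → ℝ} (hc : ∀ p, 0 < c p) (z : Queue n → ℝ) :
    ‖(WithLp.toLp 2 z : EuclideanSpace ℝ (Queue n))‖ ≤
      Real.sqrt (∑ p, 1 / c p) * cNorm c z := by
  rw [EuclideanSpace.norm_eq]
  refine Real.sqrt_le_iff.2 ⟨mul_nonneg (Real.sqrt_nonneg _) (cNorm_nonneg c z), ?_⟩
  rw [mul_pow, Real.sq_sqrt (Finset.sum_nonneg fun p _ => by have := hc p; positivity),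
    Finset.sum_mul]
  refine Finset.sum_le_sum fun p _ => ?_
  have h1 := pow_le_pow_left₀ (by positivity) (sqrt_mul_abs_le_cNorm hc z p) 2
  rw [mul_pow, Real.sq_sqrt (hc p).le] at h1
  rw [div_mul_eq_mul_div, le_div_iff₀ (hc p), Real.norm_eq_abs]
  linarith

end Switch

theorem proposition2 (n : ℕ) (c : Switch.Queue n → ℝ) (hc : ∀ p, 0 < c p)
    (ν : Switch.Queue n → ℝ) (hν : ν ∈ intrinsicInterior ℝ (Switch.face c))
    (hνpos : ∀ p, 0 < ν p) (Amax : ℕ) (σ' : ℝ) :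
    ∃ ν' : ℝ, 0 < ν' ∧ ∃ M : ℕ → ℝ,
      ∀ ε : ℝ, 0 < ε → ε < 1 → ε ≤ ν' →
        ∀ α : Switch.Queue n → MeasureTheory.Measure ℕ, Switch.IsArrivalLaw ν Amax σ' ε α →
          ∀ π : MeasureTheory.Measure (Switch.Queue n → ℕ), Switch.IsSteadyState c α π →
            ∀ r : ℕ, 1 ≤ r →
              MeasureTheory.Integrable
                (fun q => ‖(WithLp.toLp 2 (Switch.conePerp c (Switch.toReal q)) :
                  EuclideanSpace ℝ (Switch.Queue n))‖ ^ r) π ∧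
              ∫ q, ‖(WithLp.toLp 2 (Switch.conePerp c (Switch.toReal q)) :
                EuclideanSpace ℝ (Switch.Queue n))‖ ^ r ∂π ≤ M r ^ r := by
  obtain ⟨ν', θ, E, hν', hθ, hE, h⟩ :=
    Switch.exists_lintegral_exp_le c hc (intrinsicInterior_subset hν) hνpos Amax
  set C := Real.sqrt (∑ p, 1 / c p)
  have hC : 0 ≤ C := Real.sqrt_nonneg _
  have hB : ∀ r : ℕ, 0 ≤ (C / θ) ^ r * r.factorial := fun r => by positivity
  refine ⟨ν', hν', fun r => 1 + (C / θ) ^ r * r.factorial * E,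
    fun ε hε _ hεν α hα π hπ r hr => ?_⟩
  have hexp := h ε σ' α π hε hεν hα hπ
  have hV : Measurable fun q : Switch.Queue n → ℕ =>
      Real.exp (θ * Switch.cNorm c (Switch.conePerp c (Switch.toReal q))) := Measurable.of_discrete
  have hVint : Integrable (fun q : Switch.Queue n → ℕ =>
      Real.exp (θ * Switch.cNorm c (Switch.conePerp c (Switch.toReal q)))) π := by
    rw [← lintegral_ofReal_ne_top_iff_integrable hV.aestronglyMeasurable
      (Filter.Eventually.of_forall fun _ => (Real.exp_pos _).le)]
    exact ne_top_of_le_ne_top ENNReal.ofReal_ne_top hexp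
  have hVle : ∫ q, Real.exp (θ * Switch.cNorm c (Switch.conePerp c (Switch.toReal q))) ∂π ≤ E := by
    rw [integral_eq_lintegral_of_nonneg_ae
      (Filter.Eventually.of_forall fun _ => (Real.exp_pos _).le) hV.aestronglyMeasurable]
    exact ENNReal.toReal_le_of_le_ofReal hE hexp
  have hpt : ∀ q : Switch.Queue n → ℕ,
      ‖(WithLp.toLp 2 (Switch.conePerp c (Switch.toReal q)) :
        EuclideanSpace ℝ (Switch.Queue n))‖ ^ r ≤ (C / θ) ^ r * r.factorial *
          Real.exp (θ * Switch.cNorm c (Switch.conePerp c (Switch.toReal q))) := fun q => by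
    set W := Switch.cNorm c (Switch.conePerp c (Switch.toReal q))
    have hW : 0 ≤ W := Switch.cNorm_nonneg c _
    have h1 := Real.pow_div_factorial_le_exp _ (mul_nonneg hθ.le hW) r
    calc _ ≤ (C * W) ^ r := pow_le_pow_left₀ (norm_nonneg _) (Switch.norm_toLp_le hc _) r
      _ = (C / θ) ^ r * r.factorial * ((θ * W) ^ r / r.factorial) := by
        have h2 : C * W = C / θ * (θ * W) := by field_simp
        have h3 : (r.factorial : ℝ) ≠ 0 := by positivity
        rw [h2, mul_pow]
        field_simp
      _ ≤ _ := mul_le_mul_of_nonneg_left h1 (hB r)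
  have hint := (hVint.const_mul ((C / θ) ^ r * r.factorial)).mono'
    (f := fun q => ‖(WithLp.toLp 2 (Switch.conePerp c (Switch.toReal q)) :
        EuclideanSpace ℝ (Switch.Queue n))‖ ^ r)
    (Measurable.of_discrete).aestronglyMeasurable
    (Filter.Eventually.of_forall fun q => by
      rw [Real.norm_of_nonneg (pow_nonneg (norm_nonneg _) _)]; exact hpt q)
  refine ⟨hint, ?_⟩
  calc _ ≤ ∫ q, (C / θ) ^ r * r.factorial *
          Real.exp (θ * Switch.cNorm c (Switch.conePerp c (Switch.toReal q))) ∂π :=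
        integral_mono hint (hVint.const_mul _) hpt
    _ ≤ (C / θ) ^ r * r.factorial * E := by
        rw [integral_const_mul]
        exact mul_le_mul_of_nonneg_left hVle (hB r)
    _ ≤ 1 + (C / θ) ^ r * r.factorial * E := by linarith
    _ ≤ _ := le_self_pow₀ (le_add_of_nonneg_right (mul_nonneg (hB r) hE)) (by omega)
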